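/- For non-negative integers $N,K$ and integers $0\le r,s\le K$ let $C_N^{(K)}(r\to s)$ denote the number of lattice paths with steps $(1,1)$ and $(1,-1)$ from $(0,r)$ to $(N,s)$ that pass neither below the $x$-axis nor above the line $y=K$. If $K$ is odd, the sequence $N\mapsto C_N^{(K)}(r\to s)$, $N\ge 0$, has a unique extension to all $N\in\mathbb Z$ satisfying, for all $N\in\mathbb Z$, a linear recurrence with constant coefficients whose lowest and highest coefficients are non-zero; the values for $N<0$ are defined by this extension (that is, by running the recurrence backwards). Let $n$ be a non-negative integer, let $k,m$ be positive integers, and let $r_0<r_1<\dots<r_{k-1}$ and $s_0<s_1<\dots<s_{k-1}$ be integers with $1\le r_i,s_i\le k+m$ for all $i$. Let $\bar r_0<\dots<\bar r_{m-1}$ and $\bar s_0<\dots<\bar s_{m-1}$ be given by $$\{\bar r_0,\dots,\bar r_{m-1}\}=\{1,\dots,k+m\}\setminus\{r_0,\dots,r_{k-1}\},\qquad \{\bar s_0,\dots,\bar s_{m-1}\}=\{1,\dots,k+m\}\setminus\{s_0,\dots,s_{k-1}\}.$$ Then $$\det\left(C_{2n}^{(2k+2m-1)}(2r_i-2\to 2s_j-2)\right)_{0\le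 i,j\le k-1}=(-1)^{\sum_{i=0}^{m-1}(\bar r_i+\bar s_i)}\det\left(C_{-2n}^{(2k+2m-1)}(2\bar r_i-2\to 2\bar s_j-2)\right)_{0\le i,j\le m-1},$$ and, if $n\ge 1$, $$\det\left(C_{2n-1}^{(2k+2m-1)}(2r_i-2\to 2s_j-1)\right)_{0\le i,j\le k-1}=(-1)^{\sum_{i=0}^{m-1}(\bar r_i+\bar s_i)}\det\left(C_{-2n+1}^{(2k+2m-1)}(2\bar r_i-2\to 2\bar s_j-1)\right)_{0\le i,j\le m-1}.$$ -/

import Mathlib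

open Finset

/-- `C_n^{(K)}(r → s)`: the number of paths with steps `(1,1)` and `(1,-1)` from `(0,r)` to
`(n,s)` that neither pass below the `x`-axis nor above the line `y = K`.  A path is given by
its sequence of heights. -/
noncomputable def pathCount (K n : ℕ) (r s : ℤ) : ℕ :=
  Set.ncard {p : Fin (n + 1) → ℤ |
    p 0 = r ∧ p (Fin.last n) = s ∧
    (∀ i : Fin n, p i.succ = p i.castSucc + 1 ∨ p i.succ = p i.castSucc - 1) ∧
    ∀ i, 0 ≤ p i ∧ p i ≤ K}

/-- The two-sided sequence `F` extends `a` by a linear recurrence with constant coefficients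
that holds on all of `ℤ` and can be run backwards (its lowest and highest coefficients are
nonzero). -/
def IsRecurrentExtension (a : ℕ → ℚ) (F : ℤ → ℚ) : Prop :=
  (∀ n : ℕ, F n = a n) ∧
  ∃ (d : ℕ) (c : Fin (d + 1) → ℚ), c 0 ≠ 0 ∧ c (Fin.last d) ≠ 0 ∧
    ∀ n : ℤ, ∑ i : Fin (d + 1), c i * F (n + (i : ℕ)) = 0

/-- The extension of a linearly recurrent sequence to all integer indices
(the zero sequence if there is no such extension). -/
noncomputable def recurrentExtension (a : ℕ → ℚ) : ℤ → ℚ :=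
  open Classical in if h : ∃ F, IsRecurrentExtension a F then h.choose else 0

/-- `C_n^{(K)}(r → s)` for every integer `n`; for negative `n` it is obtained by running the
recurrence in `n` backwards. -/
noncomputable def extPathCount (K : ℕ) (n : ℤ) (r s : ℤ) : ℚ :=
  recurrentExtension (fun j => (pathCount K j r s : ℚ)) n

/-- A sequence has at most one recurrent extension. -/
theorem IsRecurrentExtension.unique {a : ℕ → ℚ} {F G : ℤ → ℚ}
    (hF : IsRecurrentExtension a F) (hG : IsRecurrentExtension a G) : F = G := by
  obtain ⟨hFa, d, c, hc, -, hFr⟩ := hF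
  obtain ⟨hGa, e, b, hb, -, hGr⟩ := hG
  let S : Module.End ℚ (ℤ → ℚ) := LinearMap.funLeft ℚ ℚ (fun n : ℤ => n + 1)
  have hS : ∀ (i : ℕ) (H : ℤ → ℚ) (n : ℤ), (S ^ i) H n = H (n + i) := by
    intro i
    induction i with
    | zero => intro H n; simp
    | succ i ih =>
      intro H n
      rw [pow_succ, Module.End.mul_apply, ih]
      simp only [S, LinearMap.funLeft_apply]
      congr 1
      push_cast
      ring
  let P : ∀ (d : ℕ), (Fin (d + 1) → ℚ) → Polynomial ℚ := fun d c =>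
    ∑ i : Fin (d + 1), Polynomial.monomial (i : ℕ) (c i)
  have hP : ∀ d c (H : ℤ → ℚ) (n : ℤ),
      Polynomial.aeval S (P d c) H n = ∑ i : Fin (d + 1), c i * H (n + (i : ℕ)) := by
    intro d c H n
    simp [P, Polynomial.aeval_monomial, LinearMap.sum_apply, Finset.sum_apply, hS]
  have hP0 : ∀ d c, (P d c).coeff 0 = c 0 := by
    intro d c
    simp [P, Polynomial.finsetSum_coeff, Polynomial.coeff_monomial, Fin.sum_univ_succ]
  have h1 : Polynomial.aeval S (P d c) F = 0 := by
    ext n; rw [hP]; exact hFr n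
  have h2 : Polynomial.aeval S (P e b) G = 0 := by
    ext n; rw [hP]; exact hGr n
  set R := P d c * P e b with hR
  have h3 : Polynomial.aeval S R (F - G) = 0 := by
    rw [map_sub]
    have e1 : Polynomial.aeval S R F = 0 := by
      rw [hR, mul_comm, map_mul, Module.End.mul_apply, h1, map_zero]
    have e2 : Polynomial.aeval S R G = 0 := by
      rw [hR, map_mul, Module.End.mul_apply, h2, map_zero]
    rw [e1, e2, sub_zero]
  have hR0 : R.coeff 0 ≠ 0 := by
    rw [hR, Polynomial.mul_coeff_zero, hP0, hP0]
    exact mul_ne_zero hc hb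
  have h4 : ∀ n : ℤ, ∑ i ∈ Finset.range (R.natDegree + 1),
      R.coeff i * (F - G) (n + i) = 0 := by
    intro n
    have := congrFun h3 n
    rw [Polynomial.aeval_eq_sum_range] at this
    simpa [LinearMap.sum_apply, Finset.sum_apply, hS] using this
  have h5 : ∀ N : ℕ, ∀ n : ℤ, -(N : ℤ) ≤ n → (F - G) n = 0 := by
    intro N
    induction N with
    | zero =>
      intro n hn
      lift n to ℕ using by simpa using hn
      simp [hFa, hGa]
    | succ N ih =>
      intro n hn
      by_cases h : -(N : ℤ) ≤ n
      · exact ih n h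
      have := h4 n
      rw [Finset.sum_range_succ', Finset.sum_eq_zero] at this
      · simpa [hR0] using this
      · intro i _
        rw [ih _ (by push_cast at *; omega), mul_zero]
  ext n
  have := h5 n.natAbs n (by omega)
  simpa [sub_eq_zero] using this

/-- The adjacency matrix of a path with vertices `0, …, K`. -/
def stepMatrix (K : ℕ) : Matrix (Fin (K + 1)) (Fin (K + 1)) ℚ :=
  Matrix.of fun i j => if (j : ℕ) = i + 1 ∨ (i : ℕ) = j + 1 then 1 else 0

theorem pathCount_finite (K n : ℕ) (r s : ℤ) : {p : Fin (n + 1) → ℤ |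
    p 0 = r ∧ p (Fin.last n) = s ∧
    (∀ i : Fin n, p i.succ = p i.castSucc + 1 ∨ p i.succ = p i.castSucc - 1) ∧
    ∀ i, 0 ≤ p i ∧ p i ≤ K}.Finite := by
  refine (Set.Finite.pi' (fun _ : Fin (n + 1) => Set.finite_Icc (0 : ℤ) K)).subset ?_
  rintro p ⟨-, -, -, h⟩ i
  exact h i

theorem pathCount_zero (K : ℕ) (r s : Fin (K + 1)) :
    pathCount K 0 (r : ℕ) (s : ℕ) = if r = s then 1 else 0 := by
  unfold pathCount
  split_ifs with h
  · subst h
    rw [Set.ncard_eq_one]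
    refine ⟨fun _ => ((r : ℕ) : ℤ), ?_⟩
    ext p
    simp only [Set.mem_ofPred_eq, Set.mem_singleton_iff]
    constructor
    · rintro ⟨h, -⟩
      ext i
      rw [Fin.fin_one_eq_zero i]
      exact h
    · rintro rfl
      refine ⟨rfl, rfl, fun i => i.elim0, fun i => ?_⟩
      change (0 : ℤ) ≤ ((r : ℕ) : ℤ) ∧ ((r : ℕ) : ℤ) ≤ K
      omega
  · rw [Set.ncard_eq_zero (pathCount_finite K 0 _ _), Set.eq_empty_iff_forall_notMem]
    intro p
    simp only [Set.mem_ofPred_eq]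
    rintro ⟨h1, h2, -⟩
    have : Fin.last 0 = 0 := rfl
    rw [this, h1] at h2
    exact h (Fin.ext (by exact_mod_cast h2))

theorem pathCount_out (K n : ℕ) (r s : ℤ) (hs : ¬ (0 ≤ s ∧ s ≤ K)) :
    pathCount K n r s = 0 := by
  unfold pathCount
  rw [Set.ncard_eq_zero (pathCount_finite K n _ _), Set.eq_empty_iff_forall_notMem]
  intro p
  simp only [Set.mem_ofPred_eq]
  rintro ⟨-, h2, -, h⟩
  exact hs (h2 ▸ h _)

theorem pathCount_succ (K n : ℕ) (r s : ℤ) (hs : 0 ≤ s ∧ s ≤ K) :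
    pathCount K (n + 1) r s = pathCount K n r (s - 1) + pathCount K n r (s + 1) := by
  have key : ∀ t : ℤ, (s = t + 1 ∨ s = t - 1) → Set.ncard {p : Fin (n + 1 + 1) → ℤ |
      (p 0 = r ∧ p (Fin.last (n + 1)) = s ∧
      (∀ i : Fin (n + 1), p i.succ = p i.castSucc + 1 ∨ p i.succ = p i.castSucc - 1) ∧
      ∀ i, 0 ≤ p i ∧ p i ≤ K) ∧ p (Fin.last n).castSucc = t} = pathCount K n r t := by
    intro t ht
    unfold pathCount
    symm
    refine Set.ncard_congr (fun p _ => Fin.snoc (α := fun _ => ℤ) p s) ?_ ?_ ?_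
    · rintro p ⟨h0, h1, h2, h3⟩
      refine ⟨⟨?_, ?_, ?_, ?_⟩, ?_⟩
      · rw [← Fin.castSucc_zero, Fin.snoc_castSucc, h0]
      · rw [Fin.snoc_last]
      · intro i
        refine Fin.lastCases ?_ (fun i => ?_) i
        · rw [Fin.succ_last, Fin.snoc_last, Fin.snoc_castSucc, h1]
          exact ht
        · rw [Fin.succ_castSucc, Fin.snoc_castSucc, Fin.snoc_castSucc]
          exact h2 i
      · intro i
        refine Fin.lastCases ?_ (fun i => ?_) i
        · rw [Fin.snoc_last]; exact hs
        · rw [Fin.snoc_castSucc]; exact h3 i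
      · rw [Fin.snoc_castSucc, h1]
    · intro p q _ _ h
      exact (Fin.snoc_injective2 (α := fun _ => ℤ) h).1
    · rintro p ⟨⟨h0, h1, h2, h3⟩, h4⟩
      refine ⟨Fin.init (α := fun _ => ℤ) p, ⟨?_, ?_, ?_, ?_⟩, ?_⟩
      · exact h0
      · exact h4
      · intro i
        exact h2 i.castSucc
      · intro i
        exact h3 i.castSucc
      · rw [← h1]; exact Fin.snoc_init_self p
  rw [← key (s - 1) (by left; ring), ← key (s + 1) (by right; ring), ← Set.ncard_union_eq
    ?_ ((pathCount_finite K (n + 1) r s).subset fun p h => h.1)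
    ((pathCount_finite K (n + 1) r s).subset fun p h => h.1)]
  · unfold pathCount
    congr 1
    ext p
    simp only [Set.mem_ofPred_eq, Set.mem_union]
    constructor
    · intro h
      have := h.2.2.1 (Fin.last n)
      rw [Fin.succ_last, h.2.1] at this
      rcases this with h' | h'
      · left; exact ⟨h, by linarith⟩
      · right; exact ⟨h, by linarith⟩
    · rintro (h | h) <;> exact h.1
  · rw [Set.disjoint_left]
    rintro p ⟨-, h1⟩ ⟨-, h2⟩
    omega

theorem pathCount_eq_pow (K n : ℕ) (r s : Fin (K + 1)) :
    (pathCount K n (r : ℕ) (s : ℕ) : ℚ) = (stepMatrix K ^ n) r s := by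
  induction n generalizing s with
  | zero => rw [pathCount_zero]; simp [Matrix.one_apply]
  | succ n ih =>
    rw [pathCount_succ _ _ _ _ (by omega), pow_succ, Matrix.mul_apply]
    have e : ∀ j : Fin (K + 1), (stepMatrix K ^ n) r j * stepMatrix K j s =
        (if (s : ℕ) = j + 1 then (pathCount K n (r : ℕ) (j : ℕ) : ℚ) else 0) +
        (if (j : ℕ) = s + 1 then (pathCount K n (r : ℕ) (j : ℕ) : ℚ) else 0) := by
      intro j
      rw [← ih]
      simp only [stepMatrix, Matrix.of_apply]
      split_ifs <;> first | omega | simp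
    simp_rw [e]
    rw [Finset.sum_add_distrib]
    push_cast
    congr 1
    · by_cases h : (s : ℕ) = 0
      · rw [pathCount_out _ _ _ _ (by omega), Finset.sum_eq_zero]
        · simp
        · intro j _
          rw [if_neg (by omega)]
      · rw [Finset.sum_eq_single ⟨s - 1, by omega⟩]
        · rw [if_pos (by simp only; omega)]
          congr 2
          simp only
          omega
        · intro j _ hj
          rw [if_neg]
          intro h'
          exact hj (Fin.ext (by simp only; omega))
        · simp
    · by_cases h : (s : ℕ) = K
      · rw [pathCount_out _ _ _ _ (by omega), Finset.sum_eq_zero]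
        · simp
        · intro j _
          rw [if_neg (by omega)]
      · rw [Finset.sum_eq_single ⟨s + 1, by omega⟩]
        · rw [if_pos rfl]
          congr 2
        · intro j _ hj
          rw [if_neg]
          intro h'
          exact hj (Fin.ext (by simp only; omega))
        · simp

theorem stepMatrix_det_ne_zero (K : ℕ) (hK : Odd K) : (stepMatrix K).det ≠ 0 := by
  intro h
  obtain ⟨v, hv, hv0⟩ := Matrix.exists_mulVec_eq_zero_iff.2 h
  let w : ℤ → ℚ := fun i => if h : 0 ≤ i ∧ i ≤ K then v ⟨i.toNat, by omega⟩ else 0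
  have hw : ∀ i : Fin (K + 1), w (i : ℕ) = v i := by
    intro i
    simp only [w]
    rw [dif_pos (by omega)]
    congr 1
  have hout : ∀ i : ℤ, ¬ (0 ≤ i ∧ i ≤ K) → w i = 0 := fun i hi => dif_neg hi
  have hrec : ∀ i : ℤ, 0 ≤ i → i ≤ K → w (i - 1) + w (i + 1) = 0 := by
    intro i h0 h1
    lift i to ℕ using h0
    have h1' : i < K + 1 := by omega
    have := congrFun hv0 ⟨i, h1'⟩
    rw [Matrix.mulVec, dotProduct] at this
    have e : ∀ j : Fin (K + 1), stepMatrix K ⟨i, h1'⟩ j * v j =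
        (if (i : ℤ) - 1 = (j : ℕ) then w (i - 1) else 0) +
        (if (i : ℤ) + 1 = (j : ℕ) then w (i + 1) else 0) := by
      intro j
      rw [← hw]
      simp only [stepMatrix, Matrix.of_apply]
      split_ifs with a b c d
      any_goals omega
      · rw [b]; simp
      · rw [d]; simp
      · simp
    simp_rw [e, Finset.sum_add_distrib] at this
    have f : ∀ t : ℤ, ∑ j : Fin (K + 1), (if t = (j : ℕ) then w t else 0) = w t := by
      intro t
      by_cases ht : 0 ≤ t ∧ t ≤ K
      · rw [Finset.sum_eq_single ⟨t.toNat, by omega⟩]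
        · rw [if_pos (by simp only; omega)]
        · intro j _ hj
          rw [if_neg]
          intro h'
          exact hj (Fin.ext (by simp only; omega))
        · simp
      · rw [hout t ht]; simp
    rw [f, f] at this
    simpa using this
  obtain ⟨M, hM⟩ := hK
  have hodd : ∀ j : ℕ, j ≤ M + 1 → w (2 * j - 1) = 0 := by
    intro j
    induction j with
    | zero => intro _; exact hout _ (by simp)
    | succ j ih =>
      intro hj
      have := hrec (2 * j) (by omega) (by omega)
      rw [ih (by omega), zero_add] at this
      convert this using 2
      push_cast
      ring
  have heven : ∀ j : ℕ, j ≤ M + 1 → w (K + 1 - 2 * j) = 0 := by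
    intro j
    induction j with
    | zero => intro _; exact hout _ (by simp)
    | succ j ih =>
      intro hj
      have := hrec (K - 2 * j) (by omega) (by omega)
      rw [show (K : ℤ) - 2 * j + 1 = K + 1 - 2 * j by ring, ih (by omega), add_zero] at this
      convert this using 2
      push_cast
      ring
  apply hv
  ext i
  rw [← hw]
  rcases Nat.even_or_odd' (i : ℕ) with ⟨t, ht | ht⟩
  · have := heven (M + 1 - t) (by omega)
    rw [show (K : ℤ) + 1 - 2 * ((M + 1 - t : ℕ) : ℤ) = (i : ℕ) by omega] at this
    simpa using this
  · have := hodd (t + 1) (by omega)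
    rw [show 2 * ((t + 1 : ℕ) : ℤ) - 1 = (i : ℕ) by omega] at this
    simpa using this

/-- For an odd upper bound the recurrent extension is given by the integer powers of the
adjacency matrix; in particular it exists. -/
theorem isRecurrentExtension_zpow (K : ℕ) (hK : Odd K) (r s : Fin (K + 1)) :
    IsRecurrentExtension (fun j => (pathCount K j (r : ℕ) (s : ℕ) : ℚ))
      (fun n => (stepMatrix K ^ n) r s) := by
  have hdet : IsUnit (stepMatrix K).det := (stepMatrix_det_ne_zero K hK).isUnit
  refine ⟨fun n => ?_, (stepMatrix K).charpoly.natDegree,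
    fun i => (stepMatrix K).charpoly.coeff i, ?_, ?_, ?_⟩
  · change (stepMatrix K ^ (n : ℤ)) r s = (pathCount K n (r : ℕ) (s : ℕ) : ℚ)
    rw [pathCount_eq_pow, zpow_natCast]
  · intro h
    apply stepMatrix_det_ne_zero K hK
    rw [Matrix.det_eq_sign_charpoly_coeff]
    simp only [Fin.val_zero] at h
    rw [h, mul_zero]
  · simp only [Fin.val_last]
    rw [Polynomial.coeff_natDegree, (Matrix.charpoly_monic _).leadingCoeff]
    exact one_ne_zero
  · intro n
    have h := Matrix.aeval_self_charpoly (stepMatrix K)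
    rw [Polynomial.aeval_eq_sum_range] at h
    have h' : (stepMatrix K ^ n * ∑ i ∈ Finset.range ((stepMatrix K).charpoly.natDegree + 1),
        (stepMatrix K).charpoly.coeff i • stepMatrix K ^ i) r s = 0 := by
      rw [h, mul_zero, Matrix.zero_apply]
    rw [Finset.mul_sum, Matrix.sum_apply] at h'
    rw [Fin.sum_univ_eq_sum_range
      (fun i => (stepMatrix K).charpoly.coeff i * (stepMatrix K ^ (n + (i : ℤ))) r s), ← h']
    refine Finset.sum_congr rfl fun i _ => ?_
    rw [Matrix.zpow_add hdet, zpow_natCast, Matrix.mul_smul, Matrix.smul_apply, smul_eq_mul]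

/-- For an odd upper bound, `extPathCount` is the genuine (unique) extension. -/
theorem extPathCount_spec (K : ℕ) (hK : Odd K) (r s : ℤ)
    (hr : 0 ≤ r ∧ r ≤ K) (hs : 0 ≤ s ∧ s ≤ K) :
    IsRecurrentExtension (fun j => (pathCount K j r s : ℚ))
      (fun n => extPathCount K n r s) := by
  have h : ∃ F, IsRecurrentExtension (fun j => (pathCount K j r s : ℚ)) F := by
    have := isRecurrentExtension_zpow K hK ⟨r.toNat, by omega⟩ ⟨s.toNat, by omega⟩
    simp only [Int.toNat_of_nonneg hr.1, Int.toNat_of_nonneg hs.1] at this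
    exact ⟨_, this⟩
  unfold extPathCount recurrentExtension
  simp only [dif_pos h]
  exact h.choose_spec

/-! The identity is Jacobi's complementary minor theorem for a matrix of determinant one. Let `T` be
the adjacency matrix of the path with vertices `0, …, 2L - 1`, where `L = k + m`. Path counts are
entries of powers of `T`, and by uniqueness of the recurrent extension the values at negative
lengths are entries of the negative powers.

The path is bipartite: with even vertices listed before odd ones, `T` has off-diagonal blocks `B`
and `Bᵀ`, with `B` lower triangular and ones on its diagonal. The even-even block of `T ^ (2n)` is
`(B Bᵀ) ^ n` and the even-odd block of `T ^ (2n + 1)` is `(B Bᵀ) ^ n B`; both have determinant one.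
Inverting blockwise, the corresponding block of the negative power is `A⁻¹` for the first choice of
`A` and the transpose of `A⁻¹` for the second.

Jacobi's theorem (`Matrix.det_minor_eq_det_compl_minor`) equates the minor of `A` on rows `r` and
columns `s` with a signed minor of `A⁻¹` on rows `sbar` and columns `rbar`. A transposition restores
the order of rows and columns, and the sign comes from counting inversions in
`sign_of_strictMono_blocks`. -/

/-! ### Sign of a permutation that is increasing on two blocks. -/

/-- The sign of the permutation of `{0, …, k + m - 1}` that lists first the values of `p` and then
those of `q`, both in increasing order. -/
theorem sign_of_strictMono_blocks {k m : ℕ} (σ : Equiv.Perm (Fin (k + m)))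
    (hp : StrictMono fun i : Fin k => σ (Fin.castAdd m i))
    (hq : StrictMono fun j : Fin m => σ (Fin.natAdd k j)) :
    (Equiv.Perm.sign σ : ℤ) =
      ∏ j : Fin m, ((-1) ^ (σ (Fin.natAdd k j) : ℕ) * (-1) ^ (k + (j : ℕ))) := by
  -- The value at place `j` of the second block exceeds exactly as many values as its own size, and
  -- `j` of these lie in its own block. With `hsum`, the number of inversions against the first
  -- block is `k + j` minus that value.
  have hlt : ∀ j : Fin m, ∑ i : Fin k, (if σ (Fin.castAdd m i) < σ (Fin.natAdd k j) then 1 else 0)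
      + (j : ℕ) = (σ (Fin.natAdd k j) : ℕ) := by
    intro j
    have h1 : ∑ x : Fin (k + m), (if σ x < σ (Fin.natAdd k j) then 1 else 0) =
        (σ (Fin.natAdd k j) : ℕ) := by
      rw [Equiv.sum_comp σ fun x => if x < σ (Fin.natAdd k j) then 1 else 0,
        ← Finset.card_filter, Finset.filter_gt_eq_Iio, Fin.card_Iio]
    rw [Fin.sum_univ_add] at h1
    have h2 : ∑ i : Fin m, (if σ (Fin.natAdd k i) < σ (Fin.natAdd k j) then 1 else 0) =
        (j : ℕ) := by
      rw [← Finset.card_filter]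
      have : ∀ i, σ (Fin.natAdd k i) < σ (Fin.natAdd k j) ↔ i < j := fun i => hq.lt_iff_lt
      simp_rw [this]
      rw [Finset.filter_gt_eq_Iio, Fin.card_Iio]
    omega
  have hsum : ∀ j : Fin m,
      ∑ i : Fin k, (if σ (Fin.castAdd m i) < σ (Fin.natAdd k j) then 1 else 0) +
      ∑ i : Fin k, (if σ (Fin.castAdd m i) < σ (Fin.natAdd k j) then 0 else 1) = k := by
    intro j
    rw [← Finset.sum_add_distrib]
    have : ∀ i : Fin k, (if σ (Fin.castAdd m i) < σ (Fin.natAdd k j) then 1 else 0) +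
        (if σ (Fin.castAdd m i) < σ (Fin.natAdd k j) then 0 else 1) = 1 := by
      intro i; split_ifs <;> rfl
    simp_rw [this]
    simp
  -- As a product over all indices, the inner product can be split into the two blocks.
  have hIio : ∀ (j : Fin (k + m)) (f : Fin (k + m) → ℤ),
      ∏ i ∈ Finset.Iio j, f i = ∏ i, if i < j then f i else 1 := by
    intro j f
    rw [← Finset.prod_filter, Finset.filter_gt_eq_Iio]
  rw [Equiv.Perm.sign_eq_prod_prod_Iio]
  push_cast
  simp_rw [hIio]
  rw [Fin.prod_univ_add, Finset.prod_eq_one, one_mul]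
  · refine Finset.prod_congr rfl fun j _ => ?_
    rw [Fin.prod_univ_add]
    have h2 : ∏ i : Fin m, (if Fin.natAdd k i < Fin.natAdd k j then
        (((if σ (Fin.natAdd k i) < σ (Fin.natAdd k j) then 1 else -1 : ℤˣ)) : ℤ) else 1) = 1 := by
      refine Finset.prod_eq_one fun i _ => ?_
      split_ifs with h h'
      · rfl
      · exact absurd (hq (by simpa using h)) h'
      · rfl
    have h1 : ∏ i : Fin k, (if Fin.castAdd m i < Fin.natAdd k j then
        (((if σ (Fin.castAdd m i) < σ (Fin.natAdd k j) then 1 else -1 : ℤˣ)) : ℤ) else 1) =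
        (-1) ^ ∑ i : Fin k, (if σ (Fin.castAdd m i) < σ (Fin.natAdd k j) then 0 else 1) := by
      rw [← Finset.prod_pow_eq_pow_sum]
      refine Finset.prod_congr rfl fun i _ => ?_
      rw [if_pos (by rw [Fin.lt_def]; simp; omega)]
      split_ifs <;> simp
    rw [h1, h2, mul_one, ← pow_add]
    refine neg_one_pow_congr ?_
    have := hlt j
    have := hsum j
    simp only [Nat.even_iff]
    omega
  -- An index below one of the first block is again in the first block, where `σ` is increasing: no
  -- inversions.
  · intro j _
    refine Finset.prod_eq_one fun i _ => ?_
    split_ifs with h h'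
    · rfl
    · refine absurd ?_ h'
      have hi : (i : ℕ) < k := lt_trans (Fin.lt_def.1 h) (by simp)
      exact @hp ⟨i, hi⟩ j (by simpa [Fin.lt_def] using h)
    · rfl

/-! ### Complementary minors of a matrix and its inverse. -/

/-- Jacobi's complementary minor theorem for a block decomposition. -/
theorem Matrix.det_toBlocks₁₁_of_mul_eq_one {ι κ R : Type*} [Fintype ι] [Fintype κ]
    [DecidableEq ι] [DecidableEq κ] [CommRing R] {A A' : Matrix (ι ⊕ κ) (ι ⊕ κ) R}
    (h : A * A' = 1) : A.toBlocks₁₁.det = A.det * A'.toBlocks₂₂.det := by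
  -- The right block column of `A * A' = 1` is `(0, 1)`; replacing the left block column of `A'` by
  -- that of the identity makes both sides block triangular.
  have e : A * Matrix.fromBlocks 1 A'.toBlocks₁₂ 0 A'.toBlocks₂₂ =
      Matrix.fromBlocks A.toBlocks₁₁ 0 A.toBlocks₂₁ 1 := by
    rw [← A.fromBlocks_toBlocks, ← A'.fromBlocks_toBlocks, Matrix.fromBlocks_multiply,
      ← Matrix.fromBlocks_one, Matrix.fromBlocks_inj] at h
    conv_lhs => rw [← A.fromBlocks_toBlocks]
    rw [Matrix.fromBlocks_multiply, h.2.1, h.2.2.2]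
    simp
  have := congrArg Matrix.det e
  rw [Matrix.det_mul, Matrix.det_fromBlocks_zero₂₁, Matrix.det_fromBlocks_zero₁₂] at this
  simpa using this.symm

/-- Jacobi's complementary minor theorem, for row and column sets given by permutations. -/
theorem Matrix.det_submatrix_castAdd_of_mul_eq_one {R : Type*} [CommRing R] {k m : ℕ}
    {A A' : Matrix (Fin (k + m)) (Fin (k + m)) R} (h : A * A' = 1)
    (σ τ : Equiv.Perm (Fin (k + m))) :
    (A.submatrix (fun i => σ (Fin.castAdd m i)) (fun j => τ (Fin.castAdd m j))).det =
      (Equiv.Perm.sign σ : ℤ) * (Equiv.Perm.sign τ : ℤ) * A.det *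
        (A'.submatrix (fun i => τ (Fin.natAdd k i)) (fun j => σ (Fin.natAdd k j))).det := by
  have h' : (A.submatrix (finSumFinEquiv.trans σ) (finSumFinEquiv.trans τ)) *
      (A'.submatrix (finSumFinEquiv.trans τ) (finSumFinEquiv.trans σ)) = 1 := by
    rw [Matrix.submatrix_mul_equiv, h, Matrix.submatrix_one_equiv]
  have hd : (A.submatrix (finSumFinEquiv.trans σ) (finSumFinEquiv.trans τ)).det =
      (Equiv.Perm.sign σ : ℤ) * (Equiv.Perm.sign τ : ℤ) * A.det := by
    have : A.submatrix (finSumFinEquiv.trans σ) (finSumFinEquiv.trans τ) =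
        (((A.submatrix id τ).submatrix σ id).submatrix finSumFinEquiv finSumFinEquiv) := rfl
    rw [this, Matrix.det_submatrix_equiv_self, Matrix.det_permute, Matrix.det_permute', mul_assoc]
  rw [← hd]
  exact Matrix.det_toBlocks₁₁_of_mul_eq_one h'

/-- A family and its complementary family in `{1, …, k + m}`, shifted down by one, are the two
blocks of a permutation. -/
theorem exists_perm_of_compl {k m : ℕ} {r : Fin k → ℕ} {rbar : Fin m → ℕ}
    (hr : StrictMono r) (hrbar : StrictMono rbar) (hrmem : ∀ i, r i ∈ Set.Icc 1 (k + m))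
    (hc : Set.range rbar = Set.Icc 1 (k + m) \ Set.range r) :
    ∃ σ : Equiv.Perm (Fin (k + m)), (∀ i, (σ (Fin.castAdd m i) : ℕ) + 1 = r i) ∧
      (∀ j, (σ (Fin.natAdd k j) : ℕ) + 1 = rbar j) := by
  have hmem : ∀ j, rbar j ∈ Set.Icc 1 (k + m) \ Set.range r := fun j => hc ▸ Set.mem_range_self j
  let f : Fin (k + m) → Fin (k + m) := Fin.addCases
    (fun i => ⟨r i - 1, by have := hrmem i; simp only [Set.mem_Icc] at this; omega⟩)
    (fun j => ⟨rbar j - 1, by have := (hmem j).1; simp only [Set.mem_Icc] at this; omega⟩)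
  have f1 : ∀ i, (f (Fin.castAdd m i) : ℕ) + 1 = r i := by
    intro i
    have := hrmem i
    simp only [Set.mem_Icc] at this
    simp only [f, Fin.addCases_left]
    omega
  have f2 : ∀ j, (f (Fin.natAdd k j) : ℕ) + 1 = rbar j := by
    intro j
    have := (hmem j).1
    simp only [Set.mem_Icc] at this
    simp only [f, Fin.addCases_right]
    omega
  have hf : Function.Injective f := by
    intro x y
    have hne : ∀ i j, r i ≠ rbar j := fun i j h => (hmem j).2 ⟨i, h⟩
    refine Fin.addCases (fun i => ?_) (fun i => ?_) x <;>
      refine Fin.addCases (fun j => ?_) (fun j => ?_) y <;> intro h <;>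
      replace h := congrArg (fun z : Fin (k + m) => (z : ℕ) + 1) h <;>
      simp only [f1, f2] at h
    · rw [hr.injective h]
    · exact absurd h (hne _ _)
    · exact absurd h.symm (hne _ _)
    · rw [hrbar.injective h]
  exact ⟨Equiv.ofBijective f (Finite.injective_iff_bijective.1 hf), f1, f2⟩

/-- Complementary minors of a matrix of determinant one and of its inverse. -/
theorem Matrix.det_minor_eq_det_compl_minor {R : Type*} [CommRing R] {k m : ℕ}
    {A A' : Matrix (Fin (k + m)) (Fin (k + m)) R} (h : A * A' = 1) (hA : A.det = 1)
    {σ τ : Equiv.Perm (Fin (k + m))} {r s : Fin k → ℕ} {rbar sbar : Fin m → ℕ}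
    (hr : StrictMono r) (hs : StrictMono s) (hrbar : StrictMono rbar) (hsbar : StrictMono sbar)
    (hσ : ∀ i, (σ (Fin.castAdd m i) : ℕ) + 1 = r i)
    (hσ' : ∀ j, (σ (Fin.natAdd k j) : ℕ) + 1 = rbar j)
    (hτ : ∀ i, (τ (Fin.castAdd m i) : ℕ) + 1 = s i)
    (hτ' : ∀ j, (τ (Fin.natAdd k j) : ℕ) + 1 = sbar j) :
    (A.submatrix (fun i => σ (Fin.castAdd m i)) (fun j => τ (Fin.castAdd m j))).det =
      (-1) ^ (∑ i : Fin m, (rbar i + sbar i)) *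
        (A'.submatrix (fun i => τ (Fin.natAdd k i)) (fun j => σ (Fin.natAdd k j))).det := by
  have mono : ∀ (ρ : Equiv.Perm (Fin (k + m))) {l : ℕ} (g : Fin l → Fin (k + m)) (t : Fin l → ℕ),
      StrictMono t → (∀ i, (ρ (g i) : ℕ) + 1 = t i) → StrictMono fun i => ρ (g i) := by
    intro ρ l g t ht h i j hij
    have := ht hij
    rw [← h, ← h] at this
    exact Fin.lt_def.2 (by dsimp only; omega)
  rw [Matrix.det_submatrix_castAdd_of_mul_eq_one h, hA, mul_one]
  congr 1
  rw [← Int.cast_mul, sign_of_strictMono_blocks σ (mono _ _ _ hr hσ) (mono _ _ _ hrbar hσ'),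
    sign_of_strictMono_blocks τ (mono _ _ _ hs hτ) (mono _ _ _ hsbar hτ'),
    ← Finset.prod_mul_distrib, ← Finset.prod_pow_eq_pow_sum]
  push_cast
  refine Finset.prod_congr rfl fun j _ => ?_
  rw [← pow_add, ← pow_add, ← pow_add, ← hσ', ← hτ']
  -- The terms `k + j` of the two signs occur twice and cancel modulo 2, as do the two unit shifts
  -- in `rbar` and `sbar`.
  refine neg_one_pow_congr ?_
  simp only [Nat.even_iff]
  omega

/-! ### Bipartite structure of the path and powers of its adjacency matrix. -/

/-- The block of the adjacency matrix of the path `0, …, 2L - 1` from even to odd vertices. -/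
def evenOddStep (L : ℕ) : Matrix (Fin L) (Fin L) ℚ :=
  Matrix.of fun a b => if (b : ℕ) = a ∨ (a : ℕ) = b + 1 then 1 else 0

theorem det_evenOddStep (L : ℕ) : (evenOddStep L).det = 1 := by
  rw [Matrix.det_of_isLowerTriangular]
  · simp [evenOddStep]
  · intro i j hij
    have : (i : ℕ) < j := hij
    simp only [evenOddStep, Matrix.of_apply]
    rw [if_neg (by omega)]

/-- The vertices `0, …, K = 2L - 1` split into even and odd ones. -/
noncomputable def evenOddEquiv {K L : ℕ} (h : K + 1 = 2 * L) : Fin L ⊕ Fin L ≃ Fin (K + 1) :=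
  Equiv.ofBijective
    (Sum.elim (fun a => ⟨2 * a, by omega⟩) (fun a => ⟨2 * a + 1, by omega⟩)) <| by
    constructor
    · rintro (a | a) (b | b) hab <;>
        simp only [Sum.elim_inl, Sum.elim_inr, Fin.mk.injEq] at hab <;>
        first | omega | (congr 1; omega)
    · intro x
      rcases Nat.even_or_odd' (x : ℕ) with ⟨t, ht | ht⟩
      · exact ⟨Sum.inl ⟨t, by omega⟩, Fin.ext ht.symm⟩
      · exact ⟨Sum.inr ⟨t, by omega⟩, Fin.ext ht.symm⟩

@[simp] theorem evenOddEquiv_inl {K L : ℕ} (h : K + 1 = 2 * L) (a : Fin L) :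
    (evenOddEquiv h (Sum.inl a) : ℕ) = 2 * a := rfl

@[simp] theorem evenOddEquiv_inr {K L : ℕ} (h : K + 1 = 2 * L) (a : Fin L) :
    (evenOddEquiv h (Sum.inr a) : ℕ) = 2 * a + 1 := rfl

theorem stepMatrix_submatrix_evenOddEquiv {K L : ℕ} (h : K + 1 = 2 * L) :
    (stepMatrix K).submatrix (evenOddEquiv h) (evenOddEquiv h) =
      Matrix.fromBlocks 0 (evenOddStep L) (evenOddStep L).transpose 0 := by
  ext (a | a) (b | b) <;>
    simp only [Matrix.submatrix_apply, stepMatrix, evenOddStep, Matrix.of_apply,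
      evenOddEquiv_inl, evenOddEquiv_inr, Matrix.fromBlocks_apply₁₁, Matrix.fromBlocks_apply₁₂,
      Matrix.fromBlocks_apply₂₁, Matrix.fromBlocks_apply₂₂, Matrix.transpose_apply,
      Matrix.zero_apply] <;>
    first | exact if_neg (by omega) | exact if_congr (by omega) rfl rfl

theorem Matrix.submatrix_equiv_pow {ι κ R : Type*} [Fintype ι] [Fintype κ] [DecidableEq ι]
    [DecidableEq κ] [Semiring R] (M : Matrix κ κ R) (e : ι ≃ κ) (n : ℕ) :
    (M ^ n).submatrix e e = M.submatrix e e ^ n := by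
  induction n with
  | zero => simp
  | succ n ih => rw [pow_succ, pow_succ, ← ih, Matrix.submatrix_mul_equiv]

section BipartitePower

variable {ι R : Type*} [Fintype ι] [DecidableEq ι] [CommRing R]

theorem Matrix.fromBlocks_transpose_pow_even (B : Matrix ι ι R) (n : ℕ) :
    Matrix.fromBlocks 0 B B.transpose 0 ^ (2 * n) =
      Matrix.fromBlocks ((B * B.transpose) ^ n) 0 0 ((B.transpose * B) ^ n) := by
  rw [pow_mul, sq, Matrix.fromBlocks_multiply]
  simp [Matrix.fromBlocks_diagonal_pow]

/-- `Bᵀ` intertwines `B Bᵀ` with `Bᵀ B`, so the lower left block is the transpose of the upper right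
one. This form lets one matrix describe both blocks when the power is inverted. -/
theorem Matrix.fromBlocks_transpose_pow_odd (B : Matrix ι ι R) (n : ℕ) :
    Matrix.fromBlocks 0 B B.transpose 0 ^ (2 * n + 1) =
      Matrix.fromBlocks 0 ((B * B.transpose) ^ n * B)
        ((B * B.transpose) ^ n * B).transpose 0 := by
  have e : (B.transpose * B) ^ n * B.transpose = ((B * B.transpose) ^ n * B).transpose := by
    rw [Matrix.transpose_mul, Matrix.transpose_pow, Matrix.transpose_mul,
      Matrix.transpose_transpose]
    have : SemiconjBy B.transpose (B * B.transpose) (B.transpose * B) := by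
      simp [SemiconjBy, mul_assoc]
    exact (this.pow_right n).symm
  rw [pow_succ, Matrix.fromBlocks_transpose_pow_even, Matrix.fromBlocks_multiply, ← e]
  simp

theorem Matrix.inv_fromBlocks_diagonal {A D : Matrix ι ι R} (hA : IsUnit A.det)
    (hD : IsUnit D.det) :
    (Matrix.fromBlocks A 0 0 D)⁻¹ = Matrix.fromBlocks A⁻¹ 0 0 D⁻¹ := by
  refine Matrix.inv_eq_right_inv ?_
  rw [Matrix.fromBlocks_multiply]
  simp [Matrix.mul_nonsing_inv _ hA, Matrix.mul_nonsing_inv _ hD]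

theorem Matrix.inv_fromBlocks_antidiagonal {A D : Matrix ι ι R} (hA : IsUnit A.det)
    (hD : IsUnit D.det) :
    (Matrix.fromBlocks 0 A D 0)⁻¹ = Matrix.fromBlocks 0 D⁻¹ A⁻¹ 0 := by
  refine Matrix.inv_eq_right_inv ?_
  rw [Matrix.fromBlocks_multiply]
  simp [Matrix.mul_nonsing_inv _ hA, Matrix.mul_nonsing_inv _ hD]

end BipartitePower

/-! ### Path counts of both signs as entries of blocks. -/

theorem extPathCount_eq_zpow (K : ℕ) (hK : Odd K) (z : ℤ) (r s : Fin (K + 1)) :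
    extPathCount K z (r : ℕ) (s : ℕ) = (stepMatrix K ^ z) r s :=
  congrFun ((extPathCount_spec K hK (r : ℕ) (s : ℕ) (by omega) (by omega)).unique
    (isRecurrentExtension_zpow K hK r s)) z

theorem pathCount_even_even {K L : ℕ} (h : K + 1 = 2 * L) (n : ℕ) (a b : Fin L) :
    (pathCount K (2 * n) (2 * (a : ℕ) : ℕ) (2 * (b : ℕ) : ℕ) : ℚ) =
      ((evenOddStep L * (evenOddStep L).transpose) ^ n) a b := by
  rw [← evenOddEquiv_inl h, ← evenOddEquiv_inl h, pathCount_eq_pow,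
    ← Matrix.submatrix_apply (stepMatrix K ^ (2 * n)) (evenOddEquiv h) (evenOddEquiv h),
    Matrix.submatrix_equiv_pow, stepMatrix_submatrix_evenOddEquiv,
    Matrix.fromBlocks_transpose_pow_even, Matrix.fromBlocks_apply₁₁]

theorem pathCount_even_odd {K L : ℕ} (h : K + 1 = 2 * L) (n : ℕ) (a b : Fin L) :
    (pathCount K (2 * n + 1) (2 * (a : ℕ) : ℕ) (2 * (b : ℕ) + 1 : ℕ) : ℚ) =
      ((evenOddStep L * (evenOddStep L).transpose) ^ n * evenOddStep L) a b := by
  rw [← evenOddEquiv_inl h, ← evenOddEquiv_inr h, pathCount_eq_pow,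
    ← Matrix.submatrix_apply (stepMatrix K ^ (2 * n + 1)) (evenOddEquiv h) (evenOddEquiv h),
    Matrix.submatrix_equiv_pow, stepMatrix_submatrix_evenOddEquiv,
    Matrix.fromBlocks_transpose_pow_odd, Matrix.fromBlocks_apply₁₂]

theorem extPathCount_even_even {K L : ℕ} (h : K + 1 = 2 * L) (n : ℕ) (a b : Fin L) :
    extPathCount K (-(2 * n : ℕ)) (2 * (a : ℕ) : ℕ) (2 * (b : ℕ) : ℕ) =
      ((evenOddStep L * (evenOddStep L).transpose) ^ n)⁻¹ a b := by
  have hK : Odd K := ⟨L - 1, by omega⟩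
  rw [← evenOddEquiv_inl h, ← evenOddEquiv_inl h, extPathCount_eq_zpow _ hK,
    Matrix.zpow_neg_natCast,
    ← Matrix.submatrix_apply (stepMatrix K ^ (2 * n))⁻¹ (evenOddEquiv h) (evenOddEquiv h),
    ← Matrix.inv_submatrix_equiv, Matrix.submatrix_equiv_pow, stepMatrix_submatrix_evenOddEquiv,
    Matrix.fromBlocks_transpose_pow_even, Matrix.inv_fromBlocks_diagonal,
    Matrix.fromBlocks_apply₁₁] <;>
  simp [det_evenOddStep]

/-- Inverting an antidiagonal block matrix exchanges the two blocks, so the even-odd block of the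
inverse is the inverse of the odd-even block, which is a transpose; hence the indices `b a`. -/
theorem extPathCount_even_odd {K L : ℕ} (h : K + 1 = 2 * L) (n : ℕ) (a b : Fin L) :
    extPathCount K (-(2 * n + 1 : ℕ)) (2 * (a : ℕ) : ℕ) (2 * (b : ℕ) + 1 : ℕ) =
      ((evenOddStep L * (evenOddStep L).transpose) ^ n * evenOddStep L)⁻¹ b a := by
  have hK : Odd K := ⟨L - 1, by omega⟩
  rw [← evenOddEquiv_inl h, ← evenOddEquiv_inr h, extPathCount_eq_zpow _ hK,
    Matrix.zpow_neg_natCast,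
    ← Matrix.submatrix_apply (stepMatrix K ^ (2 * n + 1))⁻¹ (evenOddEquiv h) (evenOddEquiv h),
    ← Matrix.inv_submatrix_equiv, Matrix.submatrix_equiv_pow, stepMatrix_submatrix_evenOddEquiv,
    Matrix.fromBlocks_transpose_pow_odd, Matrix.inv_fromBlocks_antidiagonal,
    Matrix.fromBlocks_apply₁₂, ← Matrix.transpose_nonsing_inv, Matrix.transpose_apply] <;>
  simp [det_evenOddStep]

theorem theorem21 (n k m : ℕ) (hk : 0 < k) (hm : 0 < m)
    (r s : Fin k → ℕ) (hr : StrictMono r) (hs : StrictMono s)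
    (hrmem : ∀ i, r i ∈ Set.Icc 1 (k + m)) (hsmem : ∀ i, s i ∈ Set.Icc 1 (k + m))
    (rbar sbar : Fin m → ℕ) (hrbar : StrictMono rbar) (hsbar : StrictMono sbar)
    (hrcompl : Set.range rbar = Set.Icc 1 (k + m) \ Set.range r)
    (hscompl : Set.range sbar = Set.Icc 1 (k + m) \ Set.range s) :
    (Matrix.of fun i j : Fin k =>
        (pathCount (2 * k + 2 * m - 1) (2 * n) (2 * r i - 2) (2 * s j - 2) : ℚ)).det =
      (-1) ^ (∑ i : Fin m, (rbar i + sbar i)) *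
      (Matrix.of fun i j : Fin m =>
        extPathCount (2 * k + 2 * m - 1) (-2 * n) (2 * rbar i - 2) (2 * sbar j - 2)).det ∧
    (0 < n →
      (Matrix.of fun i j : Fin k =>
        (pathCount (2 * k + 2 * m - 1) (2 * n - 1) (2 * r i - 2) (2 * s j - 1) : ℚ)).det =
      (-1) ^ (∑ i : Fin m, (rbar i + sbar i)) *
      (Matrix.of fun i j : Fin m =>
        extPathCount (2 * k + 2 * m - 1) (-2 * n + 1) (2 * rbar i - 2) (2 * sbar j - 1)).det) := by

  obtain ⟨σ, hσ, hσ'⟩ := exists_perm_of_compl hr hrbar hrmem hrcompl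
  obtain ⟨τ, hτ, hτ'⟩ := exists_perm_of_compl hs hsbar hsmem hscompl
  have hK : 2 * k + 2 * m - 1 + 1 = 2 * (k + m) := by omega
  -- The label `t` in `{1, …, k + m}` is the index `x = t - 1`, which stands for the even vertex
  -- `2x` or the odd vertex `2x + 1`.
  have heven : ∀ (x : Fin (k + m)) (t : ℕ), (x : ℕ) + 1 = t →
      (2 * (t : ℤ) - 2) = ((2 * (x : ℕ) : ℕ) : ℤ) := by
    intro x t h
    omega
  have hodd : ∀ (x : Fin (k + m)) (t : ℕ), (x : ℕ) + 1 = t →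
      (2 * (t : ℤ) - 1) = ((2 * (x : ℕ) + 1 : ℕ) : ℤ) := by
    intro x t h
    omega
  refine ⟨?_, fun hn => ?_⟩
  · set A := (evenOddStep (k + m) * (evenOddStep (k + m)).transpose) ^ n with hA
    have hdet : A.det = 1 := by simp [hA, det_evenOddStep]
    have hsymm : A⁻¹.transpose = A⁻¹ := by
      rw [Matrix.transpose_nonsing_inv, hA, Matrix.transpose_pow, Matrix.transpose_mul,
        Matrix.transpose_transpose]
    convert Matrix.det_minor_eq_det_compl_minor (Matrix.mul_nonsing_inv A (by simp [hdet])) hdet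
      hr hs hrbar hsbar hσ hσ' hτ hτ' using 2
    · ext i j
      rw [Matrix.of_apply, heven _ _ (hσ i), heven _ _ (hτ j), pathCount_even_even hK,
        Matrix.submatrix_apply]
    -- Jacobi's minor has rows `sbar` and columns `rbar`; transposing exchanges them, and the
    -- symmetry `hsymm` of `A⁻¹` absorbs the transposition of its entries.
    · rw [← Matrix.det_transpose]
      congr 1
      ext i j
      rw [Matrix.transpose_apply, Matrix.of_apply, heven _ _ (hσ' j), heven _ _ (hτ' i),
        show (-2 * (n : ℤ)) = -((2 * n : ℕ) : ℤ) by push_cast; ring, extPathCount_even_even hK,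
        ← hA, Matrix.submatrix_apply, ← Matrix.transpose_apply A⁻¹, hsymm]
  -- Writing `n + 1` for the positive `n` turns the truncated `2 * n - 1` into the odd length `2 * n
  -- + 1`.
  · obtain ⟨n, rfl⟩ := Nat.exists_eq_succ_of_ne_zero hn.ne'
    set A := (evenOddStep (k + m) * (evenOddStep (k + m)).transpose) ^ n *
      evenOddStep (k + m) with hA
    have hdet : A.det = 1 := by simp [hA, det_evenOddStep]
    convert Matrix.det_minor_eq_det_compl_minor (Matrix.mul_nonsing_inv A (by simp [hdet])) hdet
      hr hs hrbar hsbar hσ hσ' hτ hτ' using 2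
    · ext i j
      rw [Matrix.of_apply, heven _ _ (hσ i), hodd _ _ (hτ j),
        show 2 * n.succ - 1 = 2 * n + 1 by omega, pathCount_even_odd hK, Matrix.submatrix_apply]
    -- Here `A⁻¹` need not be symmetric, but `extPathCount_even_odd` already supplies its transposed
    -- entries.
    · rw [← Matrix.det_transpose]
      congr 1
      ext i j
      rw [Matrix.transpose_apply, Matrix.of_apply, heven _ _ (hσ' j), hodd _ _ (hτ' i),
        show (-2 * (n.succ : ℤ) + 1) = -((2 * n + 1 : ℕ) : ℤ) by push_cast; ring,
        extPathCount_even_odd hK, Matrix.submatrix_apply]
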